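/- Let $f:\mathbb{R}^n\to\mathbb{R}^n$ be a polynomial vector field with $f(0)=0$, and consider the system $\dot x=f(x)$. Let $r\ge 1$ be an integer and let $V:\mathbb{R}^n\to\mathbb{R}$ be a function of class $C^r$ that is positive definite ($V(0)=0$ and $V(x)>0$ for all $x\ne 0$) and radially unbounded ($V(x)\to\infty$ as $|x|\to\infty$). Define the Lie derivatives $L_f^1V=\nabla V\cdot f$ and $L_f^{k+1}V=\nabla(L_f^kV)\cdot f$ for $1\le k<r$, and the sets $\mathcal C^1=\{x\in\mathbb{R}^n: L_f^1V(x)=0\}$ and $\mathcal C^{k+1}=\{x\in\mathbb{R}^n: L_f^{k+1}V(x)=0\}\cap\mathcal C^k$ for $1\le k<r$. Suppose that $\dot V(x)=L_f^1V(x)\le 0$ for all $x\in\mathbb{R}^n$ and that $$\bigcap_{k=1}^r\mathcal C^k=\{0\}.$$ Then the origin is globally asymptotically stable for $\dot x=f(x)$. That is, for every $x_0\in\mathbb{R}^n$ the solution $\phi(t,x_0)$ with $\phi(0,x_0)=x_0$ exists for all $t\ge 0$ and satisfies $\phi(t,x_0)\to 0$ as $t\to\infty$; and for every $\varepsilon>0$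 there is a $\delta>0$ such that $|x_0|<\delta$ implies $|\phi(t,x_0)|<\varepsilon$ for all $t\ge 0$. -/

import Mathlib

noncomputable section

/-- `f : ℝⁿ → ℝⁿ` is a polynomial vector field: each coordinate is a real polynomial
in the `n` coordinates of the state. -/
def IsPolynomialField {n : ℕ} (f : EuclideanSpace ℝ (Fin n) → EuclideanSpace ℝ (Fin n)) : Prop :=
  ∃ P : Fin n → MvPolynomial (Fin n) ℝ, ∀ x i, f x i = MvPolynomial.eval (fun j => x j) (P i)

/-- `V` is positive definite. -/
def IsPosDefFun {n : ℕ} (V : EuclideanSpace ℝ (Fin n) → ℝ) : Prop :=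
  V 0 = 0 ∧ ∀ x, x ≠ 0 → 0 < V x

/-- `V` is radially unbounded: `V x → ∞` as `‖x‖ → ∞`. -/
def IsRadiallyUnbounded {n : ℕ} (V : EuclideanSpace ℝ (Fin n) → ℝ) : Prop :=
  Filter.Tendsto V (Filter.comap (fun x => ‖x‖) Filter.atTop) Filter.atTop

/-- The iterated Lie derivatives of `V` along `f`: `L_f^0 V = V` and
`L_f^{k+1} V = ∇ (L_f^k V) · f`. In particular `iterLie f V 1` is `∇ V · f`. -/
def iterLie {n : ℕ} (f : EuclideanSpace ℝ (Fin n) → EuclideanSpace ℝ (Fin n))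
    (V : EuclideanSpace ℝ (Fin n) → ℝ) : ℕ → EuclideanSpace ℝ (Fin n) → ℝ
  | 0 => V
  | k + 1 => fun x => inner ℝ (gradient (iterLie f V k) x) (f x)

/-- The sets `C^k`, for `k ≥ 1`: `C^1` is the zero set of `L_f^1 V`, and `C^{k+1}` is the
intersection of `C^k` with the zero set of `L_f^{k+1} V`. (`C^0` is the whole space.) -/
def lieZeroSet {n : ℕ} (f : EuclideanSpace ℝ (Fin n) → EuclideanSpace ℝ (Fin n))
    (V : EuclideanSpace ℝ (Fin n) → ℝ) : ℕ → Set (EuclideanSpace ℝ (Fin n))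
  | 0 => Set.univ
  | k + 1 => {x | iterLie f V (k + 1) x = 0} ∩ lieZeroSet f V k

/-- `φ` is a solution of `dx/dt = f x`, `x 0 = x₀`, on the whole half-line `[0, ∞)`
(the values of `φ` at negative times are irrelevant). -/
def IsForwardSolution {n : ℕ} (f : EuclideanSpace ℝ (Fin n) → EuclideanSpace ℝ (Fin n))
    (x₀ : EuclideanSpace ℝ (Fin n)) (φ : ℝ → EuclideanSpace ℝ (Fin n)) : Prop :=
  φ 0 = x₀ ∧ IsIntegralCurveOn φ (fun _ => f) (Set.Ici 0)

/-- The equilibrium `0` of `dx/dt = f x` (`f` locally Lipschitz, so that solutions are unique)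
is stable: solutions starting close to `0` exist for all `t ≥ 0` and remain close to `0`. -/
def IsStableOrigin {n : ℕ} (f : EuclideanSpace ℝ (Fin n) → EuclideanSpace ℝ (Fin n)) : Prop :=
  ∀ ε > 0, ∃ δ > 0, ∀ x₀, ‖x₀‖ < δ →
    (∃ φ, IsForwardSolution f x₀ φ) ∧
      ∀ φ, IsForwardSolution f x₀ φ → ∀ t ≥ 0, ‖φ t‖ < ε

/-- The equilibrium `0` of `dx/dt = f x` (`f` locally Lipschitz, so that solutions are unique)
is globally asymptotically stable: it is stable, and from every initial state the solution
exists for all `t ≥ 0` and tends to `0` as `t → ∞`. -/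
def IsGloballyAsymptoticallyStable {n : ℕ}
    (f : EuclideanSpace ℝ (Fin n) → EuclideanSpace ℝ (Fin n)) : Prop :=
  IsStableOrigin f ∧ ∀ x₀,
    (∃ φ, IsForwardSolution f x₀ φ) ∧
      ∀ φ, IsForwardSolution f x₀ φ → Filter.Tendsto φ Filter.atTop (nhds 0)

end

open Set Filter Topology

open scoped NNReal Manifold

section GlobalFlow

variable {E : Type*} [NormedAddCommGroup E] [NormedSpace ℝ E] [CompleteSpace E]

/-- A bounded, globally Lipschitz `C¹` vector field is complete. -/
theorem exists_isIntegralCurve_of_bounded_lipschitz {g : E → E} {K L : ℝ≥0}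
    (hg : ContDiff ℝ 1 g) (hK : LipschitzWith K g) (hL : ∀ x, ‖g x‖ ≤ L) (x : E) :
    ∃ γ : ℝ → E, γ 0 = x ∧ IsIntegralCurve γ (fun _ => g) := by
  obtain ⟨γ, h0, h⟩ := exists_isMIntegralCurve_of_isMIntegralCurveOn (I := 𝓘(ℝ, E)) (M := E)
    (v := g) (contMDiff_vectorSpace_iff_contDiff.2 hg) one_pos
    (fun y => by
      have hP : IsPicardLindelof (fun _ => g) (tmin := -1) (tmax := 1)
          ⟨0, by norm_num, by norm_num⟩ y L 0 L K :=
        .of_time_independent (fun z _ => hL z) hK.lipschitzOnWith (by simp)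
      obtain ⟨α, hα0, hα⟩ := hP.exists_eq_forall_mem_Icc_hasDerivWithinAt₀
      refine ⟨α, hα0, fun t ht => ?_⟩
      have h : HasDerivWithinAt α (g (α t)) (Ioo (-1) 1) t :=
        (hα t (Ioo_subset_Icc_self ht)).mono Ioo_subset_Icc_self
      exact h.hasFDerivWithinAt.hasMFDerivWithinAt) x
  refine ⟨γ, h0, fun t => ?_⟩
  have hd : HasFDerivAt γ ((1 : ℝ →L[ℝ] ℝ).smulRight (g (γ t))) t :=
    hasMFDerivAt_iff_hasFDerivAt.1 (h t)
  simpa using hd.hasDerivAt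

end GlobalFlow

section Lyapunov

variable {n : ℕ} {f : EuclideanSpace ℝ (Fin n) → EuclideanSpace ℝ (Fin n)}
  {V : EuclideanSpace ℝ (Fin n) → ℝ}

theorem IsPolynomialField.contDiff (hf : IsPolynomialField f) {m : WithTop ℕ∞} :
    ContDiff ℝ m f := by
  obtain ⟨P, hP⟩ := hf
  rw [contDiff_euclidean]
  intro i
  simp only [hP]
  induction P i using MvPolynomial.induction_on with
  | C a => simpa using contDiff_const
  | add p q hp hq => simpa using hp.add hq
  | mul_X p j hp =>
    simp only [map_mul, MvPolynomial.eval_X]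
    exact hp.mul (contDiff_euclidean.1 contDiff_id j)

theorem iterLie_succ_apply (k : ℕ) (x : EuclideanSpace ℝ (Fin n)) :
    iterLie f V (k + 1) x = fderiv ℝ (iterLie f V k) x (f x) :=
  inner_gradient_left

theorem contDiff_iterLie (hf : ∀ m : ℕ, ContDiff ℝ m f) {r : ℕ} (hV : ContDiff ℝ r V) :
    ∀ k m : ℕ, k + m ≤ r → ContDiff ℝ m (iterLie f V k) := by
  intro k
  induction k with
  | zero =>
    intro m hm
    exact hV.of_le (by exact_mod_cast (by omega : m ≤ r))
  | succ k ih =>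
    intro m hm
    have h := ih (m + 1) (by omega)
    rw [show iterLie f V (k + 1) = fun x => fderiv ℝ (iterLie f V k) x (f x) from
      funext (iterLie_succ_apply k)]
    exact (h.fderiv_right (by push_cast; rfl)).clm_apply (hf m)

/-- The chain rule for iterated Lie derivatives along a trajectory. -/
theorem hasDerivWithinAt_iterLie_comp {k : ℕ} {φ : ℝ → EuclideanSpace ℝ (Fin n)} {s : Set ℝ}
    {t : ℝ} (hd : Differentiable ℝ (iterLie f V k)) (h : HasDerivWithinAt φ (f (φ t)) s t) :
    HasDerivWithinAt (fun u => iterLie f V k (φ u)) (iterLie f V (k + 1) (φ t)) s t := by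
  rw [iterLie_succ_apply]
  exact (hd _).hasFDerivAt.comp_hasDerivWithinAt t h

/-- A `C¹` function whose Lie derivative is nonpositive decreases along trajectories. -/
theorem antitoneOn_comp_of_isIntegralCurveOn
    {g : EuclideanSpace ℝ (Fin n) → EuclideanSpace ℝ (Fin n)}
    {φ : ℝ → EuclideanSpace ℝ (Fin n)} (hV : Differentiable ℝ V)
    (hdot : ∀ x, fderiv ℝ V x (g x) ≤ 0) (hφ : IsIntegralCurveOn φ (fun _ => g) (Ici 0)) :
    AntitoneOn (fun t => V (φ t)) (Ici 0) := by
  have hd : ∀ t ∈ Ici (0 : ℝ),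
      HasDerivWithinAt (fun t => V (φ t)) (fderiv ℝ V (φ t) (g (φ t))) (Ici 0) t :=
    fun t ht => (hV _).hasFDerivAt.comp_hasDerivWithinAt t (hφ t ht)
  exact antitoneOn_of_hasDerivWithinAt_nonpos (convex_Ici 0)
    (fun t ht => (hd t ht).continuousWithinAt)
    (fun t ht => (hd t (interior_subset ht)).mono interior_subset) fun t _ => hdot _

theorem IsRadiallyUnbounded.isCompact_sublevel (hrad : IsRadiallyUnbounded V)
    (hV : Continuous V) (c : ℝ) : IsCompact {x | V x ≤ c} := by
  refine Metric.isCompact_of_isClosed_isBounded (isClosed_le hV continuous_const) ?_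
  have h := hrad.eventually (eventually_gt_atTop c)
  rw [eventually_comap] at h
  obtain ⟨R, hR⟩ := eventually_atTop.1 h
  refine (Metric.isBounded_iff_subset_closedBall 0).2 ⟨R, fun x hx => ?_⟩
  rw [mem_closedBall_zero_iff]
  by_contra! hlt
  exact (hR _ hlt.le x rfl).not_ge hx

theorem exists_pos_sublevel_subset_ball (hpos : IsPosDefFun V) (hrad : IsRadiallyUnbounded V)
    (hV : Continuous V) {ε : ℝ} (hε : 0 < ε) : ∃ m > 0, ∀ x, V x < m → ‖x‖ < ε := by
  have hK : IsCompact ({x | V x ≤ 1} ∩ {x | ε ≤ ‖x‖}) :=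
    (hrad.isCompact_sublevel hV 1).inter_right (isClosed_le continuous_const continuous_norm)
  rcases eq_empty_or_nonempty ({x | V x ≤ 1} ∩ {x | ε ≤ ‖x‖}) with he | hne
  · refine ⟨1, one_pos, fun x hx => ?_⟩
    by_contra! hle
    exact (he ▸ (⟨hx.le, hle⟩ : x ∈ {x | V x ≤ 1} ∩ {x | ε ≤ ‖x‖}) : x ∈ (∅ : Set _))
  · obtain ⟨z, hz, hmin⟩ := hK.exists_isMinOn hne hV.continuousOn
    refine ⟨V z, hpos.2 z (norm_pos_iff.1 (hε.trans_le hz.2)), fun x hx => ?_⟩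
    by_contra! hle
    exact hx.not_ge (hmin ⟨hx.le.trans hz.1, hle⟩)

/-- A `C¹` vector field can be cut off outside a compact set by a nonnegative bump function. -/
theorem exists_cutoff (hf : ContDiff ℝ 1 f) {S : Set (EuclideanSpace ℝ (Fin n))}
    (hS : IsCompact S) :
    ∃ (χ : EuclideanSpace ℝ (Fin n) → ℝ) (K L : ℝ≥0), (∀ x, 0 ≤ χ x) ∧ (∀ x ∈ S, χ x = 1) ∧
      ContDiff ℝ 1 (fun x => χ x • f x) ∧ LipschitzWith K (fun x => χ x • f x) ∧
      ∀ x, ‖χ x • f x‖ ≤ L := by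
  obtain ⟨R, hR0, hR⟩ := hS.isBounded.exists_pos_norm_le
  let χ : ContDiffBump (0 : EuclideanSpace ℝ (Fin n)) := ⟨R, R + 1, hR0, by linarith⟩
  have hc : ContDiff ℝ 1 (fun x => χ x • f x) := χ.contDiff.smul hf
  have hs : HasCompactSupport (fun x => χ x • f x) := χ.hasCompactSupport.smul_right
  obtain ⟨K, hK⟩ := hc.lipschitzWith_of_hasCompactSupport hs one_ne_zero
  obtain ⟨L, hL⟩ := hs.exists_bound_of_continuous hc.continuous
  exact ⟨χ, K, ⟨max L 0, le_max_right _ _⟩, fun _ => χ.nonneg,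
    fun x hx => χ.one_of_mem_closedBall (by simpa [χ] using hR x hx), hc, hK,
    fun x => (hL x).trans (le_max_left _ _)⟩

theorem IsForwardSolution.antitoneOn {x₀ : EuclideanSpace ℝ (Fin n)}
    {φ : ℝ → EuclideanSpace ℝ (Fin n)} (hV : Differentiable ℝ V)
    (hdot : ∀ x, iterLie f V 1 x ≤ 0) (hφ : IsForwardSolution f x₀ φ) :
    AntitoneOn (fun t => V (φ t)) (Ici 0) :=
  antitoneOn_comp_of_isIntegralCurveOn hV
    (fun x => (iterLie_succ_apply (f := f) (V := V) 0 x).symm.trans_le (hdot x)) hφ.2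

theorem IsForwardSolution.apply_le {x₀ : EuclideanSpace ℝ (Fin n)}
    {φ : ℝ → EuclideanSpace ℝ (Fin n)} (hV : Differentiable ℝ V)
    (hdot : ∀ x, iterLie f V 1 x ≤ 0) (hφ : IsForwardSolution f x₀ φ) {t : ℝ} (ht : 0 ≤ t) :
    V (φ t) ≤ V x₀ := by
  have h := hφ.antitoneOn hV hdot self_mem_Ici (mem_Ici.2 ht) ht
  simpa only [hφ.1] using h

/-- If `V` has compact sublevel sets and decreases along `f`, forward solutions are global. -/
theorem exists_isForwardSolution (hf : ContDiff ℝ 1 f) (hV : ContDiff ℝ 1 V)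
    (hrad : IsRadiallyUnbounded V) (hdot : ∀ x, iterLie f V 1 x ≤ 0)
    (x₀ : EuclideanSpace ℝ (Fin n)) : ∃ φ, IsForwardSolution f x₀ φ := by
  obtain ⟨χ, K, L, h0, h1, hc, hK, hL⟩ :=
    exists_cutoff hf (hrad.isCompact_sublevel hV.continuous (V x₀))
  obtain ⟨γ, hγ0, hγ⟩ := exists_isIntegralCurve_of_bounded_lipschitz hc hK hL x₀
  have hanti := antitoneOn_comp_of_isIntegralCurveOn (V := V) (hV.differentiable one_ne_zero)
    (fun x => by
      rw [map_smul, smul_eq_mul]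
      exact mul_nonpos_of_nonneg_of_nonpos (h0 x)
        ((iterLie_succ_apply (f := f) (V := V) 0 x).symm.trans_le (hdot x)))
    (hγ.isIntegralCurveOn (Ici 0))
  refine ⟨γ, hγ0, fun t ht => ?_⟩
  have hle : V (γ t) ≤ V x₀ := by simpa only [hγ0] using hanti self_mem_Ici ht ht
  have hγt : HasDerivWithinAt γ (χ (γ t) • f (γ t)) (Ici 0) t := (hγ t).hasDerivWithinAt
  rwa [h1 _ hle, one_smul] at hγt

/-- A time translate of an integral curve of a `K`-Lipschitz field separates from any other integral
curve at most at the exponential rate `K`. -/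
theorem IsIntegralCurveOn.dist_add_le {g : EuclideanSpace ℝ (Fin n) → EuclideanSpace ℝ (Fin n)}
    {K : ℝ≥0} (hK : LipschitzWith K g) {φ ψ : ℝ → EuclideanSpace ℝ (Fin n)}
    (hφ : IsIntegralCurveOn φ (fun _ => g) (Ici 0))
    (hψ : IsIntegralCurveOn ψ (fun _ => g) (Ici 0)) {t s : ℝ} (ht : 0 ≤ t) (hs : 0 ≤ s) :
    dist (φ (t + s)) (ψ s) ≤ dist (φ t) (ψ 0) * Real.exp (K * s) := by
  have hφt : ∀ u ∈ Ici (0 : ℝ), HasDerivWithinAt (fun u => φ (t + u)) (g (φ (t + u))) (Ici 0) u := by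
    intro u hu
    have h := (hφ (t + u) (add_nonneg ht hu)).scomp u
      ((hasDerivWithinAt_id u (Ici 0)).const_add t) (fun v hv => add_nonneg ht hv)
    simpa using! h
  have h := dist_le_of_trajectories_ODE (v := fun _ => g) (f := fun u => φ (t + u)) (g := ψ)
    (a := 0) (b := s) (δ := dist (φ t) (ψ 0)) (fun _ => hK)
    (fun u hu => (hφt u hu.1).continuousWithinAt.mono Icc_subset_Ici_self)
    (fun u hu => (hφt u hu.1).mono (Ici_subset_Ici.2 hu.1))
    (fun u hu => (hψ u hu.1).continuousWithinAt.mono Icc_subset_Ici_self)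
    (fun u hu => (hψ u hu.1).mono (Ici_subset_Ici.2 hu.1))
    (by simp) s ⟨hs, le_rfl⟩
  simpa using h

/-- All Lie derivatives of `V` vanish along a trajectory on which `V` is constant. -/
theorem iterLie_comp_eq_zero_of_const (hf : ∀ m : ℕ, ContDiff ℝ m f) {r : ℕ}
    (hV : ContDiff ℝ r V) {ψ : ℝ → EuclideanSpace ℝ (Fin n)}
    (hψ : IsIntegralCurveOn ψ (fun _ => f) (Ici 0)) {c : ℝ} (hc : ∀ s ≥ 0, V (ψ s) = c) :
    ∀ k < r, ∀ s ≥ 0, iterLie f V (k + 1) (ψ s) = 0 := by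
  have step : ∀ k < r, ∀ b : ℝ, (∀ s ≥ 0, iterLie f V k (ψ s) = b) →
      ∀ s ≥ 0, iterLie f V (k + 1) (ψ s) = 0 := by
    intro k hk b hb s hs
    have hd : Differentiable ℝ (iterLie f V k) :=
      (contDiff_iterLie hf hV k 1 (by omega)).differentiable (by simp)
    have h1 := hasDerivWithinAt_iterLie_comp hd (hψ s hs)
    have h2 : HasDerivWithinAt (fun u => iterLie f V k (ψ u)) 0 (Ici 0) s :=
      (hasDerivWithinAt_const s (Ici 0) b).congr (fun u hu => hb u hu) (hb s hs)
    exact (uniqueDiffOn_Ici (0 : ℝ) s hs).eq_deriv _ h1 h2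
  intro k
  induction k with
  | zero => exact fun hk => step 0 hk c hc
  | succ k ih => exact fun hk => step (k + 1) hk 0 (ih (by omega))

theorem mem_lieZeroSet {x : EuclideanSpace ℝ (Fin n)} :
    ∀ {k : ℕ}, (∀ j < k, iterLie f V (j + 1) x = 0) → x ∈ lieZeroSet f V k
  | 0, _ => mem_univ _
  | k + 1, h => ⟨h k k.lt_succ_self, mem_lieZeroSet fun j hj => h j (hj.trans k.lt_succ_self)⟩

/-- LaSalle's principle: on the trajectory issuing from a limit point of a forward solution, `V` is
constant. -/
theorem IsForwardSolution.exists_const_of_mapClusterPt (hf : ContDiff ℝ 1 f)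
    (hV : ContDiff ℝ 1 V) (hpos : IsPosDefFun V) (hrad : IsRadiallyUnbounded V)
    (hdot : ∀ x, iterLie f V 1 x ≤ 0) {x₀ y : EuclideanSpace ℝ (Fin n)}
    {φ : ℝ → EuclideanSpace ℝ (Fin n)} (hφ : IsForwardSolution f x₀ φ)
    (hy : MapClusterPt y atTop φ) :
    ∃ ψ c, IsForwardSolution f y ψ ∧ ∀ s ≥ 0, V (ψ s) = c := by
  have hVd : Differentiable ℝ V := hV.differentiable one_ne_zero
  have hnn : ∀ x, 0 ≤ V x := fun x => by
    rcases eq_or_ne x 0 with rfl | hx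
    exacts [hpos.1.ge, (hpos.2 x hx).le]
  obtain ⟨c, hc⟩ : ∃ c, Tendsto (fun t => V (φ t)) atTop (𝓝 c) := by
    have hanti : Antitone fun t => V (φ (max t 0)) := fun a b hab =>
      hφ.antitoneOn hVd hdot (le_max_right a 0) (le_max_right b 0) (max_le_max_right 0 hab)
    refine ⟨_, (tendsto_atTop_ciInf hanti
      ⟨0, forall_mem_range.2 fun t => hnn _⟩).congr' ?_⟩
    filter_upwards [eventually_ge_atTop 0] with t ht
    rw [max_eq_left ht]
  obtain ⟨ψ, hψ⟩ := exists_isForwardSolution hf hV hrad hdot y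
  refine ⟨ψ, c, hψ, fun s hs => ?_⟩
  obtain ⟨U, hU, hUy⟩ := mapClusterPt_iff_ultrafilter.1 hy
  have hyc : V y = c :=
    tendsto_nhds_unique ((hV.continuous.tendsto y).comp hUy) (hc.mono_left hU)
  have hyx : V y ≤ V x₀ := le_of_tendsto ((hV.continuous.tendsto y).comp hUy)
    (hU <| (eventually_ge_atTop 0).mono fun t ht => hφ.apply_le hVd hdot ht)
  obtain ⟨χ, K, -, -, h1, -, hK, -⟩ :=
    exists_cutoff hf (hrad.isCompact_sublevel hV.continuous (V x₀))
  have hφ' : IsIntegralCurveOn φ (fun _ x => χ x • f x) (Ici 0) := fun t ht => by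
    change HasDerivWithinAt φ (χ (φ t) • f (φ t)) (Ici 0) t
    rw [h1 _ (hφ.apply_le hVd hdot ht), one_smul]
    exact hφ.2 t ht
  have hψ' : IsIntegralCurveOn ψ (fun _ x => χ x • f x) (Ici 0) := fun t ht => by
    change HasDerivWithinAt ψ (χ (ψ t) • f (ψ t)) (Ici 0) t
    rw [h1 _ ((hψ.apply_le hVd hdot ht).trans hyx), one_smul]
    exact hψ.2 t ht
  have hlim : Tendsto (fun t => φ (t + s)) U (𝓝 (ψ s)) := by
    rw [tendsto_iff_dist_tendsto_zero]
    have hz : Tendsto (fun t => dist (φ t) (ψ 0) * Real.exp (K * s)) U (𝓝 0) := by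
      rw [hψ.1]
      simpa using (tendsto_iff_dist_tendsto_zero.1 hUy).mul_const (Real.exp (K * s))
    refine squeeze_zero' (.of_forall fun _ => dist_nonneg) ?_ hz
    exact hU <| (eventually_ge_atTop 0).mono fun t ht => hφ'.dist_add_le hK hψ' ht hs
  exact tendsto_nhds_unique ((hV.continuous.tendsto _).comp hlim)
    ((hc.comp (tendsto_atTop_add_const_right _ s tendsto_id)).mono_left hU)

/-- A positive definite radially unbounded function that decreases along `f` makes the origin
stable. -/
theorem isStableOrigin_of_lyapunov (hf : ContDiff ℝ 1 f) (hV : ContDiff ℝ 1 V)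
    (hpos : IsPosDefFun V) (hrad : IsRadiallyUnbounded V) (hdot : ∀ x, iterLie f V 1 x ≤ 0) :
    IsStableOrigin f := by
  intro ε hε
  obtain ⟨m, hm, hmε⟩ := exists_pos_sublevel_subset_ball hpos hrad hV.continuous hε
  have hnear : ∀ᶠ x in 𝓝 0, V x < m :=
    hV.continuous.continuousAt.eventually_lt_const (hpos.1.trans_lt hm)
  obtain ⟨δ, hδ, hball⟩ := Metric.eventually_nhds_iff.1 hnear
  refine ⟨δ, hδ, fun x₀ hx₀ => ⟨exists_isForwardSolution hf hV hrad hdot x₀, ?_⟩⟩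
  intro φ hφ t ht
  exact hmε _ ((hφ.apply_le (hV.differentiable one_ne_zero) hdot ht).trans_lt
    (hball (by simpa using hx₀)))

end Lyapunov

theorem proposition2 (n : ℕ)
    (f : EuclideanSpace ℝ (Fin n) → EuclideanSpace ℝ (Fin n))
    (hf : IsPolynomialField f) (hf0 : f 0 = 0)
    (V : EuclideanSpace ℝ (Fin n) → ℝ) (r : ℕ) (hr : 1 ≤ r)
    (hV : ContDiff ℝ r V)
    (hpos : IsPosDefFun V) (hrad : IsRadiallyUnbounded V)
    (hdot : ∀ x, iterLie f V 1 x ≤ 0)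
    (hC : ⋂ k ∈ Finset.Icc 1 r, lieZeroSet f V k = {0}) :
    IsGloballyAsymptoticallyStable f := by
  have hV1 : ContDiff ℝ 1 V := hV.of_le (by exact_mod_cast hr)
  refine ⟨isStableOrigin_of_lyapunov hf.contDiff hV1 hpos hrad hdot, fun x₀ =>
    ⟨exists_isForwardSolution hf.contDiff hV1 hrad hdot x₀, fun φ hφ => ?_⟩⟩
  refine (hrad.isCompact_sublevel hV1.continuous (V x₀)).le_nhds_of_unique_clusterPt ?_ ?_
  · exact (eventually_ge_atTop 0).mono fun t ht =>
      hφ.apply_le (hV1.differentiable one_ne_zero) hdot ht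
  · intro y _ hy
    obtain ⟨ψ, c, hψ, hc⟩ :=
      hφ.exists_const_of_mapClusterPt hf.contDiff hV1 hpos hrad hdot hy
    have hzero := iterLie_comp_eq_zero_of_const (fun _ => hf.contDiff) hV hψ.2 hc
    have hmem : y ∈ ⋂ k ∈ Finset.Icc 1 r, lieZeroSet f V k := by
      refine mem_iInter₂.2 fun k hk => mem_lieZeroSet fun j hj => ?_
      rw [← hψ.1]
      exact hzero j (hj.trans_le (Finset.mem_Icc.1 hk).2) 0 le_rfl
    rwa [hC] at hmem
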